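/- Let $K$ be a complete discretely valued field with normalised valuation $v_K:K\to\mathbb Z\cup\{\infty\}$ and ring of integers $O_K$, let $\bar K$ be an algebraic closure of $K$, with $v_K$ extended to $\bar K$, and put $\hat{\mathbb Q}=\mathbb Q\cup\{\infty\}$. Let $v_0$ be the Gauss valuation on $K[x]$, $v_0(\sum a_ix^i)=\min_i v_K(a_i)$. Functions $K[x]\to\hat{\mathbb Q}$ are ordered pointwise. For $v:K[x]\to\hat{\mathbb Q}$ with $v^{-1}(\infty)=\{0\}$ write $g\sim_v h$ if $v(g-h)>v(g)$, and $h\mid_v g$ if $g\sim_v qh$ for some $q\in K[x]$. A nonconstant monic $\phi\in K[x]$ is a *key polynomial* over $v$ if for all $a,b\in K[x]$: $\phi\mid_v ab$ implies $\phi\mid_v a$ or $\phi\mid_v b$; and $\phi\mid_v a$ implies $\deg a\ge\deg\phi$. For such $\phi$ and $\lambda\in\hat{\mathbb Q}$ with $\lambda>v(\phi)$, the *augmentation* $w=[v,w(\phi)=\lambda]$ is $w(\sum_i a_i\phi^i)=\min_i(v(a_i)+i\lambda)$, where $\deg a_i<\deg\phi$. A *MacLane pseudo-valuation* is a function obtained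 from $v_0$ by finitely many (possibly zero) augmentations, where every function that is augmented takes the value $\infty$ only at $0$; it is a *MacLane valuation* if it takes the value $\infty$ only at $0$ itself. The *degree* $\deg v$ of a MacLane pseudo-valuation $v$ is the degree of the key polynomial in the last augmentation of such a sequence (it does not depend on the sequence), with $\deg v_0=1$. Put $$D_v=\{\alpha\in\bar K\mid v_K(g(\alpha))\ge v(g)\text{ for all }g\in K[x]\}.$$ Let $f\in K[x]$ be a nonconstant separable polynomial with leading coefficient $c_f$ such that $f/c_f\in O_K[x]$, and let $\mathcal R\subset\bar K$ be its set of roots. A *MacLane cluster* for $f$ is a pair $(\mathfrak s,v)$ with $\mathfrak s\subseteq\mathcal R$ and $v$ a MacLane pseudo-valuation such that $\mathfrak s=D_v\cap\mathcal R\ne\varnothing$, and such that $\deg w>\deg v$ for every MacLane valuation $w>v$ with $\mathfrak s=D_w\cap\mathcal R$. For MacLane clusters write $(\mathfrak s,v)\supseteq(\mathfrak t,w)$ if $w\ge v$. **Proposition 4.9.** The set $\Sigma_f^M$ of all MacLane clusters for $f$, ordered by $\supseteq$, is a rooted tree. That is, $\supseteq$ is a partial order on $\Sigma_f^M$, there is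 a MacLane cluster (the root) containing all the others, and for every MacLane cluster the MacLane clusters containing it form a finite set that is totally ordered by $\supseteq$. -/

import Mathlib

open Polynomial

namespace MacLane

noncomputable section

/-- A relation `r` (read `r a b` as "`a` lies above `b`", here `a ⊇ b`) on a type `α` makes `α` into
a rooted tree: it is a partial order, there is a root lying above every element, and the elements
lying above a given one form a finite chain (the path to the root). -/
structure IsRootedTree {α : Type*} (r : α → α → Prop) : Prop where
  refl : ∀ a, r a a
  antisymm : ∀ a b, r a b → r b a → a = b
  trans : ∀ a b c, r a b → r b c → r a c
  exists_root : ∃ root, ∀ a, r root a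
  chain_above : ∀ a b c, r a c → r b c → r a b ∨ r b a
  finite_above : ∀ c, {a | r a c}.Finite

section

variable {K : Type*} [Field K] [Valued K (WithZero (Multiplicative ℤ))]

/-- The additive valuation `v_K : K → ℚ ∪ {∞}` of a discretely valued field (with values in
`ℤ ∪ {∞}`); Mathlib's multiplicative valuation of `a ≠ 0` is `exp (- v_K a)`. -/
def baseVal (a : K) : WithTop ℚ :=
  open Classical in
  if a = 0 then ⊤ else ((((-WithZero.log (Valued.v a) : ℤ)) : ℚ) : WithTop ℚ)

variable (K) in
/-- The unique extension of `v_K` to an algebraic extension `L` of the complete field `K`: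
`v_K(α) = v_K(N_{K(α)/K}(α)) / [K(α) : K]`, where up to sign the norm of `α` is the constant
coefficient of its minimal polynomial. -/
def extVal {L : Type*} [Field L] [Algebra K L] (α : L) : WithTop ℚ :=
  (baseVal ((minpoly K α).coeff 0)).map fun q : ℚ => q / ((minpoly K α).natDegree : ℚ)

variable (K) in
/-- The Gauss valuation `v₀(∑ aᵢ xⁱ) = minᵢ v_K(aᵢ)`. -/
def gaussVal (g : K[X]) : WithTop ℚ :=
  g.support.inf fun i => baseVal (g.coeff i)

end

section

variable {K : Type*} [Field K]

/-- `v` takes the value `∞` only at `0`. -/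
def IsFinite (v : K[X] → WithTop ℚ) : Prop :=
  ∀ g, v g = ⊤ ↔ g = 0

/-- `g` is `v`-equivalent to `h`. -/
def VEquiv (v : K[X] → WithTop ℚ) (g h : K[X]) : Prop :=
  v g < v (g - h)

/-- `h` `v`-divides `g`. -/
def VDvd (v : K[X] → WithTop ℚ) (h g : K[X]) : Prop :=
  ∃ q : K[X], VEquiv v g (q * h)

/-- `φ` is a key polynomial over `v`: (nonconstant) monic, `v`-irreducible and `v`-minimal. -/
structure IsKeyPoly (v : K[X] → WithTop ℚ) (φ : K[X]) : Prop where
  monic : φ.Monic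
  natDegree_pos : 0 < φ.natDegree
  irreducible : ∀ a b : K[X], VDvd v φ (a * b) → VDvd v φ a ∨ VDvd v φ b
  minimal : ∀ a : K[X], VDvd v φ a → φ.natDegree ≤ a.natDegree

/-- The augmentation `w = [v, w(φ) = lam]`: if `g = ∑ aᵢ φⁱ` is the `φ`-adic expansion of `g`
(`deg aᵢ < deg φ`), then `w(g) = minᵢ (v(aᵢ) + i lam)`. For a nonconstant monic `φ` the coefficient
`aᵢ` is the remainder modulo `φ` of the quotient of `g` by `φⁱ`, and it is `0` for `i > deg g`. -/
def augment (v : K[X] → WithTop ℚ) (φ : K[X]) (lam : WithTop ℚ) (g : K[X]) : WithTop ℚ :=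
  (Finset.range (g.natDegree + 1)).inf fun i => v ((g /ₘ φ ^ i) %ₘ φ) + i • lam

end

section

variable {K : Type*} [Field K] [Valued K (WithZero (Multiplicative ℤ))]

/-- MacLane pseudo-valuations: those obtained from the Gauss valuation by finitely many
augmentations, each of them (with respect to a key polynomial) of a valuation. -/
inductive IsMacLane : (K[X] → WithTop ℚ) → Prop
  | gauss : IsMacLane (gaussVal K)
  | augment (v : K[X] → WithTop ℚ) (φ : K[X]) (lam : WithTop ℚ) :
      IsMacLane v → IsFinite v → IsKeyPoly v φ → v φ < lam → IsMacLane (augment v φ lam)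

/-- `φ` is a centre of `v`: the key polynomial of the last step of a sequence of augmentations
from the Gauss valuation to `v`; by convention the centres of the Gauss valuation are the monic
integral polynomials of degree `1`. -/
def IsCentre (v : K[X] → WithTop ℚ) (φ : K[X]) : Prop :=
  (v = gaussVal K ∧ φ.Monic ∧ φ.natDegree = 1 ∧ Valued.v (φ.coeff 0) ≤ 1) ∨
  ∃ (u : K[X] → WithTop ℚ) (lam : WithTop ℚ),
    IsMacLane u ∧ IsFinite u ∧ IsKeyPoly u φ ∧ u φ < lam ∧ v = augment u φ lam

/-- The degree of a MacLane pseudo-valuation: the degree of any of its centres (centres exist and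
all have the same degree, so that the infimum is over a one-element set). -/
def deg (v : K[X] → WithTop ℚ) : ℕ :=
  sInf {d | ∃ φ, IsCentre v φ ∧ φ.natDegree = d}

variable (L : Type*) [Field L] [Algebra K L]

/-- The discoid `D_v` attached to `v`, as a subset of the algebraic closure `L` of `K`. -/
def discoid (v : K[X] → WithTop ℚ) : Set L :=
  {α | ∀ g : K[X], v g ≤ extVal K (aeval α g)}

/-- `(s, v)` is a MacLane cluster for `f`. The order on functions is the pointwise one. -/
structure IsCluster (f : K[X]) (s : Set L) (v : K[X] → WithTop ℚ) : Prop where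
  isMacLane : IsMacLane v
  eq_inter : s = discoid L v ∩ f.rootSet L
  nonempty : s.Nonempty
  deg_lt : ∀ w : K[X] → WithTop ℚ, IsMacLane w → IsFinite w → v < w →
    s = discoid L w ∩ f.rootSet L → deg v < deg w

/-- The set of all MacLane clusters for `f`. -/
def clusters (f : K[X]) : Set (Set L × (K[X] → WithTop ℚ)) :=
  {c | IsCluster L f c.1 c.2}

variable {L} in
/-- `(s, v) ⊇ (t, w)` for MacLane clusters means `w ≥ v`. -/
def Contains {f : K[X]} (c d : clusters L f) : Prop :=
  c.1.2 ≤ d.1.2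

end

end

end MacLane

namespace MacLane

/-! A cluster `(s, v)` is determined by `v`, since `s` is cut out by the discoid of `v`. So the
relation is the pointwise order on pseudo-valuations, and the partial order axioms are immediate.
Three facts remain.

Chains (`le_or_le`): let `u < w` extend `v_K`, and let `φ` be monic of least degree with `u φ < w
φ`. Then `u` is computed from `φ`-adic expansions, so it is determined by `w` in degrees below `deg
φ` and by `u φ`. For two functions below `w`, take the `φ` of smaller degree: both agree with `w`
below `deg φ`, and comparing their values at `φ` compares the functions.

Finiteness (`finite_setOf_contains`): on the chain above a cluster, the triple of root set, degree
and finiteness of `v` is injective. Two comparable valuations with equal root set and degree violate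
the maximality in the definition of a cluster, and a pseudo-valuation with nonzero support is
maximal (`eq_of_le_of_eq_top`). The triples range over a finite set, because degrees below a fixed
pseudo-valuation are bounded (`IsMacLane.exists_deg_le`).

Root (`exists_root_cluster`): among discs with centre in `O_K` containing all roots of `f` there is
a smallest one; let `ρ` be its pseudo-valuation, of degree one. If `α` is a root lying in a cluster
`(s, v)`, then `ρ` and `v` both lie below `g ↦ v_K(g(α))`, so they are comparable; `v < ρ` would
contradict the maximality of `v`, as no degree is less than one. -/

/-- `v` is an additive pseudo-valuation on the ring `R`, with values in `ℚ ∪ {∞}`. -/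
structure IsVal {R : Type*} [CommRing R] (v : R → WithTop ℚ) : Prop where
  map_zero : v 0 = ⊤
  map_one : v 1 = 0
  map_mul : ∀ a b, v (a * b) = v a + v b
  le_map_add : ∀ a b, min (v a) (v b) ≤ v (a + b)

namespace IsVal

variable {R : Type*} [CommRing R] {v : R → WithTop ℚ}

/-- The bundled additive valuation. -/
noncomputable def toAddVal (h : IsVal v) : AddValuation R (WithTop ℚ) :=
  AddValuation.of v h.map_zero h.map_one h.le_map_add h.map_mul

lemma toAddVal_apply (h : IsVal v) (a : R) : h.toAddVal a = v a := rfl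

lemma map_neg (h : IsVal v) (a : R) : v (-a) = v a := h.toAddVal.map_neg a

lemma le_map_sub (h : IsVal v) (a b : R) : min (v a) (v b) ≤ v (a - b) := h.toAddVal.map_sub a b

lemma map_add_of_lt (h : IsVal v) {a b : R} (hab : v a < v b) : v (a + b) = v a :=
  h.toAddVal.map_add_eq_of_lt_left hab

lemma comap {S : Type*} [CommRing S] (h : IsVal v) (f : S →+* R) : IsVal fun a => v (f a) where
  map_zero := by simp [h.map_zero]
  map_one := by simp [h.map_one]
  map_mul := by simp [h.map_mul]
  le_map_add a b := by simpa using h.le_map_add (f a) (f b)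

end IsVal

/-! ### The valuation of `K` -/

section

variable {K : Type*} [Field K] [Valued K (WithZero (Multiplicative ℤ))]

lemma baseVal_zero : baseVal (0 : K) = ⊤ := by simp [baseVal]

lemma baseVal_of_ne {a : K} (ha : a ≠ 0) :
    baseVal a = (((-WithZero.log (Valued.v a) : ℤ) : ℚ) : WithTop ℚ) := by
  simp [baseVal, ha]

lemma baseVal_eq_top {a : K} : baseVal a = ⊤ ↔ a = 0 := by
  by_cases ha : a = 0
  · simp [ha, baseVal_zero]
  · simp only [baseVal_of_ne ha, ha, iff_false]
    exact WithTop.coe_ne_top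

lemma baseVal_le_iff {a b : K} : baseVal a ≤ baseVal b ↔ Valued.v b ≤ Valued.v a := by
  by_cases ha : a = 0
  · subst ha
    rw [baseVal_zero, top_le_iff, baseVal_eq_top]
    simp
  by_cases hb : b = 0
  · subst hb; simp [baseVal_zero]
  have ha' : Valued.v a ≠ 0 := by simpa using ha
  have hb' : Valued.v b ≠ 0 := by simpa using hb
  rw [baseVal_of_ne ha, baseVal_of_ne hb, WithTop.coe_le_coe, Int.cast_le, neg_le_neg_iff,
    WithZero.log_le_log hb' ha']

lemma baseVal_one : baseVal (1 : K) = 0 := by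
  rw [baseVal_of_ne one_ne_zero]; simp

lemma isVal_baseVal : IsVal (baseVal : K → WithTop ℚ) where
  map_zero := baseVal_zero
  map_one := baseVal_one
  map_mul a b := by
    by_cases ha : a = 0
    · simp [ha, baseVal_zero]
    by_cases hb : b = 0
    · simp [hb, baseVal_zero]
    have ha' : Valued.v a ≠ 0 := by simpa using ha
    have hb' : Valued.v b ≠ 0 := by simpa using hb
    rw [baseVal_of_ne ha, baseVal_of_ne hb, baseVal_of_ne (mul_ne_zero ha hb), map_mul,
      WithZero.log_mul ha' hb', neg_add, Int.cast_add, WithTop.coe_add]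
  le_map_add a b := by
    rcases le_total (Valued.v a) (Valued.v b) with h | h
    · refine (min_le_right _ _).trans (baseVal_le_iff.2 ?_)
      exact (Valued.v.map_add a b).trans (max_le h le_rfl)
    · refine (min_le_left _ _).trans (baseVal_le_iff.2 ?_)
      exact (Valued.v.map_add a b).trans (max_le le_rfl h)

lemma baseVal_nonneg {a : K} : 0 ≤ baseVal a ↔ Valued.v a ≤ 1 := by
  rw [← baseVal_one (K := K), baseVal_le_iff, map_one]

end

/-! ### Extension of the valuation to the algebraic closure, by way of the spectral norm -/

section extVal

/-- The antitone embedding of `ℚ ∪ {∞}` into the nonnegative reals. -/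
noncomputable def expNeg : WithTop ℚ → ℝ
  | ⊤ => 0
  | (q : ℚ) => (2 : ℝ) ^ (-(q : ℝ))

lemma expNeg_top : expNeg ⊤ = 0 := rfl

lemma expNeg_coe (q : ℚ) : expNeg (q : WithTop ℚ) = (2 : ℝ) ^ (-(q : ℝ)) := rfl

lemma expNeg_le_iff {a b : WithTop ℚ} : expNeg a ≤ expNeg b ↔ b ≤ a := by
  induction a with
  | top =>
    simp only [expNeg_top, le_top, iff_true]
    induction b with
    | top => exact le_rfl
    | coe b => rw [expNeg_coe]; positivity
  | coe a =>
    induction b with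
    | top =>
      simp only [expNeg_top, top_le_iff, WithTop.coe_ne_top, iff_false, not_le, expNeg_coe]
      positivity
    | coe b =>
      rw [expNeg_coe, expNeg_coe, Real.rpow_le_rpow_left_iff one_lt_two, neg_le_neg_iff,
        Rat.cast_le, WithTop.coe_le_coe]

lemma expNeg_injective : Function.Injective expNeg := fun _ _ h =>
  le_antisymm (expNeg_le_iff.1 h.ge) (expNeg_le_iff.1 h.le)

lemma expNeg_add (a b : WithTop ℚ) : expNeg (a + b) = expNeg a * expNeg b := by
  induction a with
  | top => simp [expNeg_top]
  | coe a =>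
    induction b with
    | top => simp [expNeg_top]
    | coe b =>
      rw [← WithTop.coe_add, expNeg_coe, expNeg_coe, expNeg_coe, ← Real.rpow_add two_pos]
      push_cast
      ring_nf

lemma expNeg_zero : expNeg 0 = 1 := by
  have := expNeg_coe 0
  simpa using this

variable {K : Type*} [Field K] [Valued K (WithZero (Multiplicative ℤ))]

open Classical in
/-- The rank one structure for which the norm is `2 ^ (-v_K)`. -/
@[reducible] noncomputable def rankOne
    (hK : Function.Surjective (Valued.v : Valuation K (WithZero (Multiplicative ℤ)))) :
    (Valued.v : Valuation K (WithZero (Multiplicative ℤ))).RankOne where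
  hom' := (WithZeroMulInt.toNNReal (e := 2) two_ne_zero).comp MonoidWithZeroHom.ValueGroup₀.embedding
  strictMono' := (WithZeroMulInt.toNNReal_strictMono one_lt_two).comp
    MonoidWithZeroHom.ValueGroup₀.embedding_strictMono
  exists_val_nontrivial := by
    obtain ⟨x, hx⟩ := hK (WithZero.exp 1)
    refine ⟨x, ?_, ?_⟩
    · rw [hx]; exact WithZero.exp_ne_zero
    · rw [hx, ← WithZero.exp_zero]
      intro h
      simpa using WithZero.exp_injective h

/-- Over a complete field `extVal` is a valuation extending `v_K`. -/
lemma isVal_extVal [CompleteSpace K]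
    (hK : Function.Surjective (Valued.v : Valuation K (WithZero (Multiplicative ℤ))))
    (L : Type*) [Field L] [Algebra K L] [Algebra.IsAlgebraic K L] :
    IsVal (extVal K : L → WithTop ℚ) ∧ ∀ c : K, extVal K (algebraMap K L c) = baseVal c := by
  let := rankOne hK
  let : NontriviallyNormedField K := Valued.toNontriviallyNormedField K (WithZero (Multiplicative ℤ))
  have : IsUltrametricDist K := inferInstance
  have hnorm : ∀ c : K, ‖c‖ = expNeg (baseVal c) := by
    intro c
    have h1 : ‖c‖ = (WithZeroMulInt.toNNReal (e := 2) two_ne_zero (Valued.v c) : ℝ) := by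
      rw [← Valuation.embedding_restrict]
      rfl
    rw [h1]
    by_cases hc : c = 0
    · simp [hc, baseVal_zero, expNeg_top]
    · have hc' : Valued.v c ≠ 0 := by simpa using hc
      rw [WithZeroMulInt.toNNReal_neg_apply _ hc', WithZero.toAdd_unzero_eq_log, baseVal_of_ne hc,
        expNeg_coe]
      push_cast
      rw [neg_neg, Real.rpow_intCast]
  -- Over a complete field the spectral norm is the norm of the constant coefficient of the minimal
  -- polynomial, raised to the power one over the degree. It is multiplicative and ultrametric, and
  -- `expNeg` carries this back to `extVal`.
  have hext : ∀ x : L, expNeg (extVal K x) = spectralNorm K L x := by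
    intro x
    have hd : 0 < (minpoly K x).natDegree :=
      minpoly.natDegree_pos (Algebra.IsIntegral.isIntegral x)
    rw [spectralNorm.spectralNorm_eq_norm_coeff_zero_rpow, hnorm, extVal]
    induction baseVal ((minpoly K x).coeff 0) with
    | top =>
      rw [WithTop.map_top, expNeg_top, Real.zero_rpow]
      positivity
    | coe q =>
      rw [WithTop.map_coe, expNeg_coe, expNeg_coe, ← Real.rpow_mul two_pos.le]
      push_cast
      ring_nf
  have hmul : ∀ x y : L, spectralNorm K L (x * y) = spectralNorm K L x * spectralNorm K L y :=
    spectralAlgNorm_mul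
  have hna : IsNonarchimedean (spectralNorm K L) := isNonarchimedean_spectralNorm
  refine ⟨⟨?_, ?_, ?_, ?_⟩, ?_⟩
  · exact expNeg_injective (by rw [hext, spectralNorm_zero, expNeg_top])
  · exact expNeg_injective (by rw [hext, spectralNorm_one, expNeg_zero])
  · intro a b
    exact expNeg_injective (by rw [hext, hmul, expNeg_add, hext, hext])
  · intro a b
    have := hna a b
    rw [← hext, ← hext, ← hext, le_max_iff, expNeg_le_iff, expNeg_le_iff] at this
    rwa [min_le_iff]
  · intro c
    exact expNeg_injective (by rw [hext, spectralNorm_extends, hnorm])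

end extVal

/-! ### Functions given by `φ`-adic expansions, and comparison of pseudo-valuations -/

section expansion

variable {K : Type*} [Field K]

/-- Induction along the `φ`-adic expansion. -/
lemma expansion_induction {φ : K[X]} (hm : φ.Monic) (hd : 0 < φ.natDegree) {P : K[X] → Prop}
    (zero : P 0) (step : ∀ a b, a.natDegree < φ.natDegree → P b → P (a + φ * b)) (g : K[X]) :
    P g := by
  induction h : g.natDegree using Nat.strong_induction_on generalizing g with
  | _ n ih =>
    by_cases hg : g.natDegree < φ.natDegree
    · simpa using step g 0 hg zero
    · rw [← modByMonic_add_div g φ]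
      refine step _ _ (natDegree_modByMonic_lt g hm ?_) (ih _ ?_ _ rfl)
      · rintro rfl; simp at hd
      · rw [natDegree_divByMonic g hm]; omega

lemma exists_expansion {φ : K[X]} (hm : φ.Monic) (hd : 0 < φ.natDegree) (g : K[X]) :
    ∃ a b, a.natDegree < φ.natDegree ∧ g = a + φ * b :=
  expansion_induction hm hd (P := fun g => ∃ a b, a.natDegree < φ.natDegree ∧ g = a + φ * b)
    ⟨0, 0, by simpa using hd, by simp⟩ (fun a b ha _ => ⟨a, b, ha, rfl⟩) g

/-- The value of `w` is computed from the `φ`-adic expansion, with `φ` having value `lam`. -/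
structure HasExp (w : K[X] → WithTop ℚ) (φ : K[X]) (lam : WithTop ℚ) : Prop where
  monic : φ.Monic
  natDegree_pos : 0 < φ.natDegree
  map_add_mul : ∀ a b : K[X], a.natDegree < φ.natDegree → w (a + φ * b) = min (w a) (lam + w b)

namespace HasExp

variable {w v : K[X] → WithTop ℚ} {φ : K[X]} {lam : WithTop ℚ}

lemma map_mul_left (h : HasExp w φ lam) (h0 : w 0 = ⊤) (b : K[X]) : w (φ * b) = lam + w b := by
  have := h.map_add_mul 0 b (by simpa using h.natDegree_pos)
  simpa [h0] using this

lemma map_self (h : HasExp w φ lam) (hw : IsVal w) : w φ = lam := by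
  have := h.map_mul_left hw.map_zero 1
  simpa [hw.map_one] using this

lemma le_of_le (h : HasExp w φ lam) (hv : IsVal v)
    (hsmall : ∀ a : K[X], a.natDegree < φ.natDegree → w a ≤ v a) (hlam : lam ≤ v φ) : w ≤ v := by
  intro g
  induction g using expansion_induction h.monic h.natDegree_pos with
  | zero => rw [hv.map_zero]; exact le_top
  | step a b ha ih =>
    rw [h.map_add_mul a b ha]
    refine le_trans ?_ (hv.le_map_add _ _)
    rw [hv.map_mul]
    exact min_le_min (hsmall a ha) (add_le_add hlam ih)

section

-- Apart from the expansion formula, the conditions concern only polynomials of degree below `deg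
-- φ`. They serve both the Gauss valuation (`φ = X`, `lam = 0`, constant coefficients) and
-- augmentations.
variable (h : HasExp w φ lam) (h0 : w 0 = ⊤)
  (hadd : ∀ a b : K[X], a.natDegree < φ.natDegree → b.natDegree < φ.natDegree →
    min (w a) (w b) ≤ w (a + b))
  (hneg : ∀ a : K[X], a.natDegree < φ.natDegree → w a ≤ w (-a))
  (hmul : ∀ a b : K[X], a.natDegree < φ.natDegree → b.natDegree < φ.natDegree →
    ∃ r q : K[X], r.natDegree < φ.natDegree ∧ a * b = r + φ * q ∧ w r = w a + w b ∧
      w a + w b ≤ lam + w q)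

include h hadd

lemma le_map_add (g k : K[X]) : min (w g) (w k) ≤ w (g + k) := by
  induction g using expansion_induction h.monic h.natDegree_pos generalizing k with
  | zero => simp
  | step a b ha ih =>
    obtain ⟨c, d, hc, rfl⟩ := exists_expansion h.monic h.natDegree_pos k
    have hs : a + φ * b + (c + φ * d) = (a + c) + φ * (b + d) := by ring
    rw [hs, h.map_add_mul a b ha, h.map_add_mul c d hc,
      h.map_add_mul _ _ ((natDegree_add_le a c).trans_lt (max_lt ha hc))]
    have h1 := hadd a c ha hc
    have h2 : min (lam + w b) (lam + w d) ≤ lam + w (b + d) := by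
      rw [min_add_add_left]
      exact add_le_add_right (ih d) lam
    refine le_min (le_trans ?_ h1) (le_trans ?_ h2)
    · exact min_le_min (min_le_left _ _) (min_le_left _ _)
    · exact min_le_min (min_le_right _ _) (min_le_right _ _)

include h0 hmul

lemma le_map_mul_small (g b : K[X]) (hb : b.natDegree < φ.natDegree) :
    w g + w b ≤ w (g * b) := by
  induction g using expansion_induction h.monic h.natDegree_pos with
  | zero => simp [h0]
  | step a g ha ih =>
    obtain ⟨r, q, hr, hab, hwr, hwq⟩ := hmul a b ha hb
    have hs : (a + φ * g) * b = r + φ * (q + g * b) := by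
      linear_combination hab
    rw [hs, h.map_add_mul r _ hr, h.map_add_mul a g ha, hwr]
    refine le_min (add_le_add_left (min_le_left _ _) _) ?_
    refine le_trans ?_ (add_le_add_right (h.le_map_add hadd q (g * b)) lam)
    rw [← min_add_add_left]
    refine le_min ((add_le_add_left (min_le_left _ _) _).trans hwq) ?_
    refine (add_le_add_left (min_le_right _ _) _).trans ?_
    rw [add_assoc]
    exact add_le_add_right ih lam

lemma le_map_mul (g k : K[X]) : w g + w k ≤ w (g * k) := by
  induction k using expansion_induction h.monic h.natDegree_pos with
  | zero => simp [h0]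
  | step b k hb ih =>
    have hs : g * (b + φ * k) = g * b + φ * (g * k) := by ring
    rw [hs, h.map_add_mul b k hb]
    refine le_trans ?_ (h.le_map_add hadd _ _)
    rw [h.map_mul_left h0]
    refine le_min ?_ ?_
    · exact (add_le_add_right (min_le_left _ _) _).trans (h.le_map_mul_small h0 hadd hmul g b hb)
    · refine (add_le_add_right (min_le_right _ _) _).trans ?_
      rw [add_left_comm]
      exact add_le_add_right ih lam

include hneg

/-- Only `≤` is new. In a counterexample, either a factor attains its minimum strictly away from its
constant term, and splitting off that term leads back to a shorter expansion, or both minima are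
attained at the constant terms, whose product cannot cancel. -/
lemma map_mul (g k : K[X]) : w (g * k) = w g + w k := by
  refine le_antisymm ?_ (h.le_map_mul h0 hadd hmul g k)
  induction k using expansion_induction h.monic h.natDegree_pos generalizing g with
  | zero => simp [h0]
  | step b k hb ihk =>
    set k' := b + φ * k with hk'
    have hwk : w k' = min (w b) (lam + w k) := h.map_add_mul b k hb
    induction g using expansion_induction h.monic h.natDegree_pos with
    | zero => simp [h0]
    | step a g ha ihg =>
      set g' := a + φ * g with hg'
      have hwg : w g' = min (w a) (lam + w g) := h.map_add_mul a g ha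
      by_contra hcon
      rw [not_le] at hcon
      have hfin : w g' + w k' ≠ ⊤ := hcon.ne_top
      rw [WithTop.add_ne_top] at hfin
      -- Here `φ * (g' * k) = g' * k' - g' * b`, where both terms on the right have value above `w
      -- g' + w k'`, while by induction the left side does not.
      by_cases h1 : w k' < w b
      · have hwk' : w k' = lam + w k := by
          rw [hwk] at h1 ⊢
          exact min_eq_right (not_lt.1 fun hlt => by simp [min_eq_left hlt.le] at h1)
        have e1 : w (φ * (g' * k)) ≤ w g' + w k' := by
          rw [h.map_mul_left h0, hwk', add_left_comm]
          exact add_le_add_right (ihk g') lam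
        have e2 : w g' + w k' < w (g' * (-b)) :=
          (WithTop.add_lt_add_left hfin.1 (h1.trans_le (hneg b hb))).trans_le
            (h.le_map_mul_small h0 hadd hmul g' (-b) (by simpa using hb))
        have e3 := h.le_map_add hadd (g' * k') (g' * (-b))
        have e4 : g' * k' + g' * (-b) = φ * (g' * k) := by rw [hk']; ring
        rw [e4] at e3
        exact (lt_min hcon e2).not_ge (e3.trans e1)
      by_cases h2 : w g' < w a
      · have hwg' : w g' = lam + w g := by
          rw [hwg] at h2 ⊢
          exact min_eq_right (not_lt.1 fun hlt => by simp [min_eq_left hlt.le] at h2)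
        have e1 : w (φ * (g * k')) ≤ w g' + w k' := by
          rw [h.map_mul_left h0, hwg', add_assoc]
          exact add_le_add_right ihg lam
        have e2 : w g' + w k' < w (k' * (-a)) := by
          rw [add_comm]
          exact (WithTop.add_lt_add_left hfin.2 (h2.trans_le (hneg a ha))).trans_le
            (h.le_map_mul_small h0 hadd hmul k' (-a) (by simpa using ha))
        have e3 := h.le_map_add hadd (g' * k') (k' * (-a))
        have e4 : g' * k' + k' * (-a) = φ * (g * k') := by rw [hg']; ring
        rw [e4] at e3
        exact (lt_min hcon e2).not_ge (e3.trans e1)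
      -- Now `w g' = w a` and `w k' = w b`, and the constant term `r` of the product has value
      -- exactly `w a + w b`.
      · obtain ⟨r, q, hr, hab, hwr, -⟩ := hmul a b ha hb
        have hs : g' * k' = r + φ * (q + a * k + g * b + φ * (g * k)) := by
          rw [hg', hk']; linear_combination hab
        refine hcon.not_ge ?_
        rw [hs, h.map_add_mul r _ hr, hwr]
        exact (min_le_left _ _).trans (add_le_add (not_lt.1 h2) (not_lt.1 h1))

lemma isVal (h1 : w 1 = 0) : IsVal w where
  map_zero := h0
  map_one := h1
  map_mul := h.map_mul h0 hadd hneg hmul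
  le_map_add := h.le_map_add hadd

end

end HasExp

/-- If `u ≤ w` agree in degree less than `deg φ`, but not at `φ`, then `u` is determined by the
`φ`-adic expansion. -/
lemma hasExp_of_lt {u w : K[X] → WithTop ℚ} (hu : IsVal u) (hw : IsVal w) (huw : u ≤ w)
    {φ : K[X]} (hm : φ.Monic) (hd : 0 < φ.natDegree)
    (hsmall : ∀ a : K[X], a.natDegree < φ.natDegree → u a = w a) (hlt : u φ < w φ) :
    HasExp u φ (u φ) where
  monic := hm
  natDegree_pos := hd
  map_add_mul a b ha := by
    rw [← hu.map_mul]
    refine le_antisymm ?_ (hu.le_map_add _ _)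
    by_contra hcon
    rw [not_le] at hcon
    rcases lt_trichotomy (u a) (u (φ * b)) with h | h | h
    · rw [hu.map_add_of_lt h, min_eq_left h.le] at hcon
      exact lt_irrefl _ hcon
    -- Cancellation in `u` is excluded by `w`: since `u φ < w φ`, the value `w (φ * b)` exceeds `w
    -- a`, so `w (a + φ * b) = w a = u a < u (a + φ * b)`, against `u ≤ w`.
    · rw [← h, min_self] at hcon
      have hb : u b ≠ ⊤ := by
        intro hb
        rw [hu.map_mul, hb, WithTop.add_top] at h
        rw [h] at hcon
        exact not_top_lt hcon
      have h1 : w a < w (φ * b) := by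
        rw [← hsmall a ha, h, hu.map_mul, hw.map_mul]
        exact (WithTop.add_lt_add_right hb hlt).trans_le (add_le_add_right (huw b) _)
      have h2 := huw (a + φ * b)
      rw [hw.map_add_of_lt h1, ← hsmall a ha] at h2
      exact hcon.not_ge h2
    · rw [add_comm, hu.map_add_of_lt h, min_eq_right h.le] at hcon
      exact lt_irrefl _ hcon

lemma exists_hasExp {u w : K[X] → WithTop ℚ} (hu : IsVal u) (hw : IsVal w) (huw : u ≤ w)
    (hne : u ≠ w) (hC : ∀ c, u (C c) = w (C c)) :
    ∃ φ : K[X], HasExp u φ (u φ) ∧ u φ < w φ ∧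
      ∀ a : K[X], a.natDegree < φ.natDegree → u a = w a := by
  classical
  have hex : ∃ n, ∃ φ : K[X], φ.natDegree = n ∧ u φ < w φ := by
    by_contra! hcon
    exact hne (le_antisymm huw fun g => hcon _ g rfl)
  obtain ⟨φ, hφn, hφ⟩ := Nat.find_spec hex
  have hsmall : ∀ a : K[X], a.natDegree < φ.natDegree → u a = w a := by
    intro a ha
    refine le_antisymm (huw a) (not_lt.1 fun hlt => ?_)
    exact Nat.find_min hex (hφn ▸ ha) ⟨a, rfl, hlt⟩
  have hd : 0 < φ.natDegree := by
    refine Nat.pos_of_ne_zero fun h0 => ?_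
    rw [eq_C_of_natDegree_eq_zero h0, hC] at hφ
    exact lt_irrefl _ hφ
  have hφ0 : φ ≠ 0 := by rintro rfl; simp at hd
  -- Rescaling by a unit constant, whose value is finite and the same for `u` and `w`, makes `φ`
  -- monic and keeps the inequality strict.
  have hlc : φ.leadingCoeff⁻¹ ≠ 0 := inv_ne_zero (leadingCoeff_ne_zero.2 hφ0)
  have hdeg : (φ * C φ.leadingCoeff⁻¹).natDegree = φ.natDegree :=
    natDegree_mul_C hlc
  have hm : (φ * C φ.leadingCoeff⁻¹).Monic := monic_mul_leadingCoeff_inv hφ0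
  have hfin : u (C φ.leadingCoeff⁻¹) ≠ ⊤ := by
    intro htop
    have := hu.map_mul (C φ.leadingCoeff⁻¹) (C φ.leadingCoeff)
    rw [htop, ← C_mul, inv_mul_cancel₀ (leadingCoeff_ne_zero.2 hφ0), C_1, hu.map_one,
      WithTop.top_add] at this
    exact WithTop.zero_ne_top this
  have hlt : u (φ * C φ.leadingCoeff⁻¹) < w (φ * C φ.leadingCoeff⁻¹) := by
    rw [hu.map_mul, hw.map_mul, ← hC]
    exact WithTop.add_lt_add_right hfin hφ
  have hsm : ∀ a : K[X], a.natDegree < (φ * C φ.leadingCoeff⁻¹).natDegree → u a = w a := by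
    rwa [hdeg]
  exact ⟨_, hasExp_of_lt hu hw huw hm (by rwa [hdeg]) hsm hlt, hlt, hsm⟩

/-- The pseudo-valuations below a given one form a chain. -/
lemma le_or_le {u v w : K[X] → WithTop ℚ} (hu : IsVal u) (hv : IsVal v) (hw : IsVal w)
    (huw : u ≤ w) (hvw : v ≤ w) (huC : ∀ c, u (C c) = w (C c)) (hvC : ∀ c, v (C c) = w (C c)) :
    u ≤ v ∨ v ≤ u := by
  -- If `v φ < u φ`, then also `v φ < w φ`, so `v` too is given by `φ`-adic expansions; the argument
  -- is then symmetric.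
  have aux : ∀ {u v : K[X] → WithTop ℚ} {φ : K[X]}, IsVal u → IsVal v → v ≤ w → u ≤ w →
      HasExp u φ (u φ) → (∀ a : K[X], a.natDegree < φ.natDegree → u a = w a) →
      (∀ a : K[X], a.natDegree < φ.natDegree → v a = w a) → u ≤ v ∨ v ≤ u := by
    intro u v φ hu hv hvw huw hexp hsu hsv
    rcases le_or_gt (u φ) (v φ) with h | h
    · exact .inl (hexp.le_of_le hv (fun a ha => (hsu a ha).trans_le (hsv a ha).ge) h)
    · exact .inr ((hasExp_of_lt hv hw hvw hexp.monic hexp.natDegree_pos hsv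
        (h.trans_le (huw φ))).le_of_le hu (fun a ha => (hsv a ha).trans_le (hsu a ha).ge) h.le)
  by_cases hne : u = w
  · exact .inr (hne ▸ hvw)
  by_cases hne' : v = w
  · exact .inl (hne' ▸ huw)
  obtain ⟨φ, hφ, -, hsφ⟩ := exists_hasExp hu hw huw hne huC
  obtain ⟨ψ, hψ, -, hsψ⟩ := exists_hasExp hv hw hvw hne' hvC
  rcases le_total φ.natDegree ψ.natDegree with h | h
  · exact aux hu hv hvw huw hφ hsφ fun a ha => hsψ a (ha.trans_le h)
  · exact (aux hv hu huw hvw hψ hsψ fun a ha => hsφ a (ha.trans_le h)).symm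

lemma IsVal.map_add_of_top {R : Type*} [CommRing R] {v : R → WithTop ℚ} (h : IsVal v) (a : R)
    {b : R} (hb : v b = ⊤) : v (a + b) = v a :=
  h.toAddVal.map_add_supp a hb

/-- A pseudo-valuation with nontrivial support is maximal. -/
lemma eq_of_le_of_eq_top {u w : K[X] → WithTop ℚ} (hu : IsVal u) (hw : IsVal w) (huw : u ≤ w)
    (hC : ∀ c, u (C c) = w (C c)) {ψ : K[X]} (hψ0 : ψ ≠ 0) (hψ : u ψ = ⊤) : u = w := by
  classical
  by_contra hne
  obtain ⟨φ, hφ, hlt, hsmall⟩ := exists_hasExp hu hw huw hne hC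
  have hex : ∃ n, ∃ ψ : K[X], ψ.natDegree = n ∧ ψ ≠ 0 ∧ u ψ = ⊤ := ⟨_, ψ, rfl, hψ0, hψ⟩
  obtain ⟨θ, hn, hθ0, hθ⟩ := Nat.find_spec hex
  -- Otherwise the quotient of `θ` by `φ` is a smaller nonzero element of the support, because `u φ`
  -- is finite.
  have hdeg : θ.natDegree < φ.natDegree := by
    by_contra hle
    have h1 := hφ.map_add_mul (θ %ₘ φ) (θ /ₘ φ) (natDegree_modByMonic_lt θ hφ.monic
      (by rintro rfl; simpa using hφ.natDegree_pos))
    rw [modByMonic_add_div, hθ, eq_comm, min_eq_top, WithTop.add_eq_top] at h1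
    have hpos := hφ.natDegree_pos
    have hq := natDegree_divByMonic θ hφ.monic
    refine Nat.find_min hex (m := (θ /ₘ φ).natDegree) (by omega) ⟨_, rfl, ?_, ?_⟩
    · intro h0
      rw [divByMonic_eq_zero_iff hφ.monic] at h0
      exact hle (natDegree_lt_natDegree hθ0 h0)
    · exact h1.2.resolve_left hlt.ne_top
  -- Modulo the support, `φ` may be replaced by its remainder by `θ`, where `u` and `w` agree.
  have hr : (φ % θ).natDegree < φ.natDegree :=
    (natDegree_le_natDegree (EuclideanDomain.mod_lt φ hθ0).le).trans_lt hdeg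
  have hwθ : w θ = ⊤ := top_le_iff.1 (hθ ▸ huw θ)
  have e := EuclideanDomain.mod_add_div φ θ
  have e1 : u φ = u (φ % θ) := by
    conv_lhs => rw [← e]
    exact hu.map_add_of_top _ (by rw [hu.map_mul, hθ, WithTop.top_add])
  have e2 : w φ = w (φ % θ) := by
    conv_lhs => rw [← e]
    exact hw.map_add_of_top _ (by rw [hw.map_mul, hwθ, WithTop.top_add])
  rw [e1, e2, hsmall _ hr] at hlt
  exact lt_irrefl _ hlt

end expansion

/-! ### Augmentations are pseudo-valuations -/

section augment

variable {K : Type*} [Field K] {v : K[X] → WithTop ℚ} {φ : K[X]} {lam : WithTop ℚ}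

/-- Terms beyond the truncation are `∞`, so the minimum runs over all `i`. The shift `c` gives
access to `lam + augment v φ lam b`, as needed for the recursion along the expansion. -/
lemma le_add_augment_iff (h0 : v 0 = ⊤) (hm : φ.Monic) (hd : 0 < φ.natDegree) (g : K[X])
    (x c : WithTop ℚ) :
    x ≤ c + augment v φ lam g ↔ ∀ i : ℕ, x ≤ c + (v ((g /ₘ φ ^ i) %ₘ φ) + i • lam) := by
  have hmono : Monotone fun y : WithTop ℚ => c + y := fun a b hab => add_le_add_right hab c
  rw [augment, Finset.apply_inf_eq_inf_comp_of_linearOrder _ hmono (WithTop.add_top c),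
    Finset.le_inf_iff]
  refine ⟨fun h i => ?_, fun h i _ => h i⟩
  by_cases hi : i ∈ Finset.range (g.natDegree + 1)
  · exact h i hi
  · have hz : g /ₘ φ ^ i = 0 := by
      refine (divByMonic_eq_zero_iff (hm.pow i)).2 (degree_lt_degree ?_)
      rw [hm.natDegree_pow]
      rw [Finset.mem_range] at hi
      nlinarith
    rw [hz, zero_modByMonic, h0, WithTop.top_add, WithTop.add_top]
    exact le_top

lemma le_augment_iff (h0 : v 0 = ⊤) (hm : φ.Monic) (hd : 0 < φ.natDegree) (g : K[X])
    (x : WithTop ℚ) :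
    x ≤ augment v φ lam g ↔ ∀ i : ℕ, x ≤ v ((g /ₘ φ ^ i) %ₘ φ) + i • lam := by
  simpa using le_add_augment_iff (lam := lam) h0 hm hd g x 0

lemma add_mul_divByMonic_pow_succ (hm : φ.Monic) (a b : K[X]) (ha : a.natDegree < φ.natDegree)
    (i : ℕ) : (a + φ * b) /ₘ φ ^ (i + 1) = b /ₘ φ ^ i := by
  refine (div_modByMonic_unique _ (a + φ * (b %ₘ φ ^ i)) (hm.pow _) ⟨?_, ?_⟩).1
  · have := modByMonic_add_div b (φ ^ i)
    linear_combination φ * this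
  · refine (degree_add_le _ _).trans_lt (max_lt ?_ ?_)
    · refine degree_lt_degree (ha.trans_le ?_)
      rw [hm.natDegree_pow]
      exact Nat.le_mul_of_pos_left _ i.succ_pos
    · rw [pow_succ', degree_mul, degree_mul]
      have h1 : φ.degree ≠ ⊥ := degree_ne_bot.2 hm.ne_zero
      exact WithBot.add_lt_add_left h1 (degree_modByMonic_lt _ (hm.pow i))

lemma augment_add_mul (h0 : v 0 = ⊤) (hm : φ.Monic) (hd : 0 < φ.natDegree) (a b : K[X])
    (ha : a.natDegree < φ.natDegree) :
    augment v φ lam (a + φ * b) = min (v a) (lam + augment v φ lam b) := by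
  refine eq_of_forall_le_iff fun x => ?_
  have hmod : (a + φ * b) %ₘ φ = a :=
    (div_modByMonic_unique b a hm ⟨rfl, degree_lt_degree ha⟩).2
  rw [le_augment_iff h0 hm hd, le_min_iff, le_add_augment_iff h0 hm hd]
  constructor
  · intro h
    refine ⟨by simpa [hmod] using h 0, fun i => ?_⟩
    have := h (i + 1)
    rwa [add_mul_divByMonic_pow_succ hm a b ha, succ_nsmul', add_left_comm] at this
  · rintro ⟨h1, h2⟩ (_ | i)
    · simpa [hmod] using h1
    · rw [add_mul_divByMonic_pow_succ hm a b ha, succ_nsmul', add_left_comm]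
      exact h2 i

lemma augment_zero (h0 : v 0 = ⊤) : augment v φ lam 0 = ⊤ := by
  simp [augment, h0]

lemma augment_of_natDegree_lt (h0 : v 0 = ⊤) (hm : φ.Monic) (hd : 0 < φ.natDegree) {a : K[X]}
    (ha : a.natDegree < φ.natDegree) : augment v φ lam a = v a := by
  have := augment_add_mul (lam := lam) h0 hm hd a 0 ha
  simpa [augment_zero h0] using this

lemma hasExp_augment (h0 : v 0 = ⊤) (hm : φ.Monic) (hd : 0 < φ.natDegree) :
    HasExp (augment v φ lam) φ lam where
  monic := hm
  natDegree_pos := hd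
  map_add_mul a b ha := by
    rw [augment_add_mul h0 hm hd a b ha, augment_of_natDegree_lt h0 hm hd ha]

namespace IsKeyPoly

lemma not_vDvd (hφ : IsKeyPoly v φ) {a : K[X]} (ha : a.natDegree < φ.natDegree) :
    ¬ VDvd v φ a :=
  fun h => ha.not_ge (hφ.minimal a h)

/-- If the sum had larger value, `φ` would `v`-divide `a`, against minimality. -/
lemma map_add_mul_le (hφ : IsKeyPoly v φ) {a : K[X]} (ha : a.natDegree < φ.natDegree)
    (b : K[X]) : v (a + φ * b) ≤ v a := by
  refine not_lt.1 fun h => hφ.not_vDvd ha ⟨-b, ?_⟩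
  rw [VEquiv]
  convert h using 2
  ring

lemma hasExp (hφ : IsKeyPoly v φ) (hv : IsVal v) : HasExp v φ (v φ) where
  monic := hφ.monic
  natDegree_pos := hφ.natDegree_pos
  map_add_mul a b ha := by
    rw [← hv.map_mul]
    refine le_antisymm (le_min (hφ.map_add_mul_le ha b) ?_) (hv.le_map_add _ _)
    have h1 := hv.le_map_sub (a + φ * b) a
    rwa [add_sub_cancel_left, min_eq_left (hφ.map_add_mul_le ha b)] at h1

lemma isVal_augment (hφ : IsKeyPoly v φ) (hv : IsVal v) (hlam : v φ < lam) :
    IsVal (augment v φ lam) := by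
  have h0 := hv.map_zero
  have hsm : ∀ {a : K[X]}, a.natDegree < φ.natDegree → augment v φ lam a = v a :=
    augment_of_natDegree_lt h0 hφ.monic hφ.natDegree_pos
  refine (hasExp_augment h0 hφ.monic hφ.natDegree_pos).isVal (augment_zero h0) ?_ ?_ ?_ ?_
  · intro a b ha hb
    rw [hsm ha, hsm hb, hsm ((natDegree_add_le a b).trans_lt (max_lt ha hb))]
    exact hv.le_map_add a b
  · intro a ha
    rw [hsm ha, hsm (by simpa using ha), hv.map_neg]
  · intro a b ha hb
    by_cases hab : a * b = 0
    · refine ⟨0, 0, by simpa using hφ.natDegree_pos, by simp [hab], ?_, ?_⟩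
      · rw [augment_zero h0, hsm ha, hsm hb, ← hv.map_mul, hab, h0]
      · simp [augment_zero h0]
    have hφ1 : φ ≠ 1 := by
      rintro rfl
      simpa using hφ.natDegree_pos
    have hr : ((a * b) %ₘ φ).natDegree < φ.natDegree := natDegree_modByMonic_lt _ hφ.monic hφ1
    have hq : ((a * b) /ₘ φ).natDegree < φ.natDegree := by
      rw [natDegree_divByMonic _ hφ.monic]
      have := natDegree_mul_le (p := a) (q := b)
      have := hφ.natDegree_pos
      omega
    have e := modByMonic_add_div (a * b) φ
    -- A remainder of larger value would mean that `φ` `v`-divides `a * b`, hence one factor, which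
    -- has too small a degree.
    have hle : v ((a * b) %ₘ φ) ≤ v (a * b) := by
      refine not_lt.1 fun hlt => ?_
      have hdvd : VDvd v φ (a * b) := by
        refine ⟨(a * b) /ₘ φ, ?_⟩
        rw [VEquiv]
        convert hlt using 2
        linear_combination -e
      exact (hφ.irreducible a b hdvd).elim (hφ.not_vDvd ha) (hφ.not_vDvd hb)
    have hge : v (a * b) ≤ v ((a * b) %ₘ φ) := by
      have := hφ.map_add_mul_le hr ((a * b) /ₘ φ)
      rwa [e] at this
    have heq := le_antisymm hle hge
    refine ⟨_, _, hr, e.symm, ?_, ?_⟩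
    · rw [hsm hr, hsm ha, hsm hb, heq, hv.map_mul]
    · rw [hsm ha, hsm hb, hsm hq, ← hv.map_mul]
      have h1 := hv.le_map_sub (a * b) ((a * b) %ₘ φ)
      have h2 : a * b - (a * b) %ₘ φ = φ * ((a * b) /ₘ φ) := by linear_combination -e
      rw [h2, heq, min_self, hv.map_mul φ] at h1
      exact h1.trans (add_le_add_left hlam.le _)
  · rw [hsm (by simpa using hφ.natDegree_pos), hv.map_one]

lemma le_augment (hφ : IsKeyPoly v φ) (hv : IsVal v) (hlam : v φ < lam) :
    v ≤ augment v φ lam := by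
  refine (hφ.hasExp hv).le_of_le (hφ.isVal_augment hv hlam) ?_ ?_
  · intro a ha
    rw [augment_of_natDegree_lt hv.map_zero hφ.monic hφ.natDegree_pos ha]
  · rw [(hasExp_augment hv.map_zero hφ.monic hφ.natDegree_pos).map_self
      (hφ.isVal_augment hv hlam)]
    exact hlam.le

lemma isFinite_augment (hφ : IsKeyPoly v φ) (hfin : IsFinite v) (htop : lam ≠ ⊤) :
    IsFinite (augment v φ lam) := by
  have h0 : v 0 = ⊤ := (hfin 0).2 rfl
  refine fun g => ⟨fun hg => ?_, fun hg => hg ▸ augment_zero h0⟩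
  induction g using expansion_induction hφ.monic hφ.natDegree_pos with
  | zero => rfl
  | step a b ha ih =>
    rw [augment_add_mul h0 hφ.monic hφ.natDegree_pos a b ha, min_eq_top, hfin,
      WithTop.add_eq_top] at hg
    rw [hg.1, ih (hg.2.resolve_left htop)]
    simp

end IsKeyPoly

end augment

/-! ### The Gauss valuation and its linear key polynomials -/

section gauss

variable {K : Type*} [Field K] [Valued K (WithZero (Multiplicative ℤ))]

lemma le_gaussVal_iff (g : K[X]) (x : WithTop ℚ) :
    x ≤ gaussVal K g ↔ ∀ i, x ≤ baseVal (g.coeff i) := by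
  rw [gaussVal, Finset.le_inf_iff]
  refine ⟨fun h i => ?_, fun h i _ => h i⟩
  by_cases hi : i ∈ g.support
  · exact h i hi
  · rw [notMem_support_iff.1 hi, baseVal_zero]
    exact le_top

lemma gaussVal_C (c : K) : gaussVal K (C c) = baseVal c := by
  refine eq_of_forall_le_iff fun x => ?_
  rw [le_gaussVal_iff]
  constructor
  · intro h; simpa using h 0
  · rintro h (_ | i)
    · simpa using h
    · simp [baseVal_zero]

lemma hasExp_gaussVal_X : HasExp (gaussVal K) X 0 where
  monic := monic_X
  natDegree_pos := by simp
  map_add_mul a b ha := by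
    rw [natDegree_X, Nat.lt_one_iff] at ha
    rw [eq_C_of_natDegree_eq_zero ha, gaussVal_C, zero_add]
    refine eq_of_forall_le_iff fun x => ?_
    rw [le_min_iff, le_gaussVal_iff, le_gaussVal_iff]
    constructor
    · intro h
      exact ⟨by simpa using h 0, fun i => by simpa [coeff_C] using h (i + 1)⟩
    · rintro ⟨h1, h2⟩ (_ | i)
      · simpa using h1
      · simpa [coeff_C] using h2 i

lemma isVal_gaussVal : IsVal (gaussVal K) := by
  have hsm : ∀ {a : K[X]}, a.natDegree < (X : K[X]).natDegree → ∃ c, a = C c := by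
    intro a ha
    rw [natDegree_X, Nat.lt_one_iff] at ha
    exact ⟨_, eq_C_of_natDegree_eq_zero ha⟩
  refine hasExp_gaussVal_X.isVal (by simp [gaussVal]) ?_ ?_ ?_ ?_
  · intro a b ha hb
    obtain ⟨a, rfl⟩ := hsm ha
    obtain ⟨b, rfl⟩ := hsm hb
    rw [← C_add, gaussVal_C, gaussVal_C, gaussVal_C]
    exact isVal_baseVal.le_map_add a b
  · intro a ha
    obtain ⟨a, rfl⟩ := hsm ha
    rw [← C_neg, gaussVal_C, gaussVal_C, isVal_baseVal.map_neg]
  · intro a b ha hb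
    obtain ⟨a, rfl⟩ := hsm ha
    obtain ⟨b, rfl⟩ := hsm hb
    refine ⟨C (a * b), 0, by rw [natDegree_C, natDegree_X]; exact one_pos, by simp, ?_, by simp [gaussVal]⟩
    rw [gaussVal_C, gaussVal_C, gaussVal_C, isVal_baseVal.map_mul]
  · rw [← C_1, gaussVal_C, baseVal_one]

lemma isFinite_gaussVal : IsFinite (gaussVal K) := by
  refine fun g => ⟨fun hg => ?_, fun hg => hg ▸ isVal_gaussVal.map_zero⟩
  ext i
  rw [coeff_zero, ← baseVal_eq_top, ← top_le_iff]
  exact (le_gaussVal_iff g ⊤).1 hg.ge i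

/-- The Gauss valuation lies below every extension of `v_K` for which `x` is integral. -/
lemma gaussVal_le {v : K[X] → WithTop ℚ} (hv : IsVal v) (hC : ∀ c, v (C c) = baseVal c)
    (hX : 0 ≤ v X) : gaussVal K ≤ v := by
  refine hasExp_gaussVal_X.le_of_le hv (fun a ha => ?_) hX
  rw [natDegree_X, Nat.lt_one_iff] at ha
  rw [eq_C_of_natDegree_eq_zero ha, gaussVal_C, hC]

lemma gaussVal_le_baseVal_eval {a : K} (ha : 0 ≤ baseVal a) (g : K[X]) :
    gaussVal K g ≤ baseVal (g.eval a) :=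
  gaussVal_le (v := fun g => baseVal (g.eval a)) (isVal_baseVal.comap (evalRingHom a))
    (by simp) (by simpa using ha) g

/-- The remainder of `g` by `X - C a` is the constant `g(a)`. This reduces the key polynomial axioms
to facts about the valuation `g ↦ v_K(g(a))`, which lies above the Gauss valuation. -/
lemma vDvd_X_sub_C_iff {a : K} (ha : 0 ≤ baseVal a) (g : K[X]) :
    VDvd (gaussVal K) (X - C a) g ↔ gaussVal K g < baseVal (g.eval a) := by
  constructor
  · rintro ⟨q, hq⟩
    rw [VEquiv] at hq
    simpa using hq.trans_le (gaussVal_le_baseVal_eval ha (g - q * (X - C a)))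
  · intro h
    refine ⟨g /ₘ (X - C a), ?_⟩
    have e := modByMonic_add_div g (X - C a)
    rw [modByMonic_X_sub_C_eq_C_eval] at e
    have e' : g - g /ₘ (X - C a) * (X - C a) = C (g.eval a) := by linear_combination -e
    rwa [VEquiv, e', gaussVal_C]

lemma isKeyPoly_X_sub_C {a : K} (ha : 0 ≤ baseVal a) : IsKeyPoly (gaussVal K) (X - C a) where
  monic := monic_X_sub_C a
  natDegree_pos := by simp
  irreducible g h := by
    simp only [vDvd_X_sub_C_iff ha, isVal_gaussVal.map_mul, eval_mul, isVal_baseVal.map_mul]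
    contrapose!
    exact fun h => add_le_add h.1 h.2
  minimal g := by
    rw [vDvd_X_sub_C_iff ha, natDegree_X_sub_C]
    contrapose!
    intro hg
    rw [eq_C_of_natDegree_eq_zero (Nat.lt_one_iff.1 hg), gaussVal_C, eval_C]

lemma gaussVal_X_sub_C {a : K} (ha : 0 ≤ baseVal a) : gaussVal K (X - C a) = 0 := by
  have h := hasExp_gaussVal_X.map_add_mul (C (-a)) 1 (by simp)
  have e : C (-a) + X * 1 = X - C a := by rw [C_neg]; ring
  rwa [e, gaussVal_C, isVal_baseVal.map_neg, isVal_gaussVal.map_one, add_zero, min_eq_right ha]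
    at h

end gauss

/-! ### MacLane pseudo-valuations and bounded degrees -/

section isMacLane

variable {K : Type*} [Field K] [Valued K (WithZero (Multiplicative ℤ))] {v w : K[X] → WithTop ℚ}

lemma IsMacLane.isVal_and (hv : IsMacLane v) :
    IsVal v ∧ (∀ c, v (C c) = baseVal c) ∧ gaussVal K ≤ v := by
  induction hv with
  | gauss => exact ⟨isVal_gaussVal, gaussVal_C, le_rfl⟩
  | augment v φ lam hv hfin hφ hlam ih =>
    refine ⟨hφ.isVal_augment ih.1 hlam, fun c => ?_, ih.2.2.trans
      (hφ.le_augment ih.1 hlam)⟩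
    rw [augment_of_natDegree_lt ih.1.map_zero hφ.monic hφ.natDegree_pos
      (by simpa using hφ.natDegree_pos), ih.2.1]

lemma IsMacLane.isVal (hv : IsMacLane v) : IsVal v := hv.isVal_and.1

lemma IsMacLane.map_C (hv : IsMacLane v) (c : K) : v (C c) = baseVal c := hv.isVal_and.2.1 c

lemma IsMacLane.gaussVal_le (hv : IsMacLane v) : gaussVal K ≤ v := hv.isVal_and.2.2

lemma IsMacLane.le_or_le {u : K[X] → WithTop ℚ} (hu : IsMacLane u) (hv : IsMacLane v)
    (hw : IsVal w) (hwC : ∀ c, w (C c) = baseVal c) (huw : u ≤ w) (hvw : v ≤ w) :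
    u ≤ v ∨ v ≤ u :=
  MacLane.le_or_le hu.isVal hv.isVal hw huw hvw (fun c => by rw [hu.map_C, hwC])
    fun c => by rw [hv.map_C, hwC]

lemma IsMacLane.eq_of_le (hv : IsMacLane v) (hw : IsMacLane w) (hvw : v ≤ w)
    (hfin : ¬ IsFinite v) : v = w := by
  have : ∃ ψ, ψ ≠ 0 ∧ v ψ = ⊤ := by
    by_contra! h
    refine hfin fun g => ⟨fun hg => ?_, fun hg => hg ▸ hv.isVal.map_zero⟩
    by_contra hg0
    exact h g hg0 hg
  obtain ⟨ψ, hψ0, hψ⟩ := this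
  exact eq_of_le_of_eq_top hv.isVal hw.isVal hvw (fun c => by rw [hv.map_C, hw.map_C]) hψ0 hψ

lemma IsMacLane.exists_isCentre (hv : IsMacLane v) : ∃ φ, IsCentre v φ := by
  cases hv with
  | gauss => exact ⟨X, .inl ⟨rfl, monic_X, natDegree_X, by simp⟩⟩
  | augment u φ lam hu hfin hφ hlam => exact ⟨φ, .inr ⟨u, lam, hu, hfin, hφ, hlam, rfl⟩⟩

lemma IsMacLane.exists_natDegree_eq_deg (hv : IsMacLane v) :
    ∃ φ, IsCentre v φ ∧ φ.natDegree = deg v :=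
  Nat.sInf_mem (s := {d | ∃ φ, IsCentre v φ ∧ φ.natDegree = d})
    (hv.exists_isCentre.imp' natDegree fun φ hφ => ⟨φ, hφ, rfl⟩)

lemma IsCentre.deg_le {φ : K[X]} (h : IsCentre v φ) : deg v ≤ φ.natDegree :=
  Nat.sInf_le ⟨φ, h, rfl⟩

lemma IsMacLane.one_le_deg (hv : IsMacLane v) : 1 ≤ deg v := by
  obtain ⟨φ, hφ, hdeg⟩ := hv.exists_natDegree_eq_deg
  rw [← hdeg]
  rcases hφ with ⟨-, -, h, -⟩ | ⟨u, lam, -, -, hφ, -⟩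
  · exact h.ge
  · exact hφ.natDegree_pos

/-- The degrees of the pseudo-valuations below a given one are bounded. -/
lemma IsMacLane.exists_deg_le (hw : IsMacLane w) :
    ∃ N, ∀ v : K[X] → WithTop ℚ, IsMacLane v → v ≤ w → deg v ≤ N := by
  induction hw with
  | gauss =>
    refine ⟨1, fun v hv hle => ?_⟩
    obtain rfl := le_antisymm hle hv.gaussVal_le
    simpa using (IsCentre.deg_le (.inl ⟨rfl, monic_X, natDegree_X, by simp⟩ : IsCentre (gaussVal K) X))
  | augment u φ lam hu hfin hφ hlam ih =>
    obtain ⟨N, hN⟩ := ih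
    have hw : IsMacLane (MacLane.augment u φ lam) := .augment u φ lam hu hfin hφ hlam
    have hexp : HasExp (MacLane.augment u φ lam) φ lam :=
      hasExp_augment hu.isVal.map_zero hφ.monic hφ.natDegree_pos
    have hsm : ∀ {mu : WithTop ℚ} {a : K[X]}, a.natDegree < φ.natDegree →
        MacLane.augment u φ mu a = u a :=
      augment_of_natDegree_lt hu.isVal.map_zero hφ.monic hφ.natDegree_pos
    refine ⟨max N φ.natDegree, fun v hv hle => ?_⟩
    have huw := hφ.le_augment hu.isVal hlam
    by_cases hvu : v ≤ u
    · exact (hN v hv hvu).trans (le_max_left _ _)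
    refine le_trans (IsCentre.deg_le ?_) (le_max_right _ _)
    -- Now `u ≤ v ≤ w`, so `v` agrees with `u` below `deg φ`. Hence `v` is itself the augmentation
    -- of `u` at `φ` with value `v φ`, and `φ` is a centre of `v`.
    have huv := (hu.le_or_le hv hw.isVal hw.map_C huw hle).resolve_right hvu
    have hsv : ∀ a : K[X], a.natDegree < φ.natDegree → v a = u a := fun a ha =>
      le_antisymm ((hle a).trans_eq (hsm ha)) (huv a)
    have hwφ := hexp.map_self hw.isVal
    rcases (hle φ).lt_or_eq with hlt | heq
    · have hvexp := hasExp_of_lt hv.isVal hw.isVal hle hφ.monic hφ.natDegree_pos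
        (fun a ha => (hsv a ha).trans (hsm ha).symm) hlt
      have huφ : u φ < v φ := by
        refine not_le.1 fun h => hvu (hvexp.le_of_le hu.isVal (fun a ha => (hsv a ha).le) h)
      have hexp' : HasExp (MacLane.augment u φ (v φ)) φ (v φ) :=
        hasExp_augment hu.isVal.map_zero hφ.monic hφ.natDegree_pos
      have hval' := hφ.isVal_augment hu.isVal huφ
      refine .inr ⟨u, v φ, hu, hfin, hφ, huφ, le_antisymm ?_ ?_⟩
      · exact hvexp.le_of_le hval' (fun a ha => by rw [hsm ha, hsv a ha])
          (hexp'.map_self hval').ge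
      · exact hexp'.le_of_le hv.isVal (fun a ha => by rw [hsm ha, hsv a ha]) le_rfl
    · refine .inr ⟨u, lam, hu, hfin, hφ, hlam, le_antisymm hle ?_⟩
      exact hexp.le_of_le hv.isVal (fun a ha => by rw [hsm ha, hsv a ha]) (hwφ ▸ heq.ge)

end isMacLane

variable {K : Type*} [Field K] [Valued K (WithZero (Multiplicative ℤ))]

/-- The MacLane pseudo-valuation of degree one given by a closed disc with a centre in `K`. -/
lemma exists_isMacLane_hasExp_X_sub_C {a : K} (ha : 0 ≤ baseVal a) {lam : WithTop ℚ}
    (hlam : 0 ≤ lam) :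
    ∃ ρ : K[X] → WithTop ℚ, IsMacLane ρ ∧ HasExp ρ (X - C a) lam ∧ deg ρ ≤ 1 ∧
      (lam ≠ ⊤ → IsFinite ρ) := by
  have hkey := isKeyPoly_X_sub_C ha
  -- Radius `0` is not a proper augmentation, since the Gauss valuation of `X - C a` is already `0`;
  -- there the Gauss valuation itself serves.
  rcases hlam.lt_or_eq with h | rfl
  · have hlt : gaussVal K (X - C a) < lam := by rwa [gaussVal_X_sub_C ha]
    refine ⟨_, .augment _ _ lam .gauss isFinite_gaussVal hkey hlt,
      hasExp_augment isVal_gaussVal.map_zero hkey.monic hkey.natDegree_pos, ?_,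
      hkey.isFinite_augment isFinite_gaussVal⟩
    have hc : IsCentre (augment (gaussVal K) (X - C a) lam) (X - C a) :=
      .inr ⟨_, lam, .gauss, isFinite_gaussVal, hkey, hlt, rfl⟩
    simpa using hc.deg_le
  · refine ⟨gaussVal K, .gauss, ?_, ?_, fun _ => isFinite_gaussVal⟩
    · simpa [gaussVal_X_sub_C ha] using hkey.hasExp isVal_gaussVal
    · have hc : IsCentre (gaussVal K) X := .inl ⟨rfl, monic_X, natDegree_X, by simp⟩
      simpa using hc.deg_le

/-- Comparison with the pseudo-valuation of a disc with centre in `K`. -/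
lemma HasExp.le_of_X_sub_C {ρ v : K[X] → WithTop ℚ} {a : K} {lam : WithTop ℚ}
    (h : HasExp ρ (X - C a) lam) (hρ : ∀ c, ρ (C c) = baseVal c) (hv : IsVal v)
    (hC : ∀ c, v (C c) = baseVal c) (hlam : lam ≤ v (X - C a)) : ρ ≤ v := by
  refine h.le_of_le hv (fun b hb => ?_) hlam
  rw [natDegree_X_sub_C, Nat.lt_one_iff] at hb
  rw [eq_C_of_natDegree_eq_zero hb, hρ, hC]

/-! ### Clusters above a given one: chain and finiteness -/

section clusters

variable {L : Type*} [Field L] [Algebra K L] {f : K[X]}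

/-- Maximality in the definition of a cluster tests only against valuations; in the other case `v`
has nonzero support and is maximal anyway. -/
lemma IsCluster.eq_of_le {s : Set L} {v w : K[X] → WithTop ℚ} (hv : IsCluster L f s v)
    (hw : IsCluster L f s w) (hdeg : deg v = deg w) (hfin : IsFinite v ↔ IsFinite w)
    (hvw : v ≤ w) : v = w := by
  by_cases h : IsFinite v
  · by_contra hne
    exact (hv.deg_lt w hw.isMacLane (hfin.1 h) (lt_of_le_of_ne hvw hne) hw.eq_inter).ne hdeg
  · exact hv.isMacLane.eq_of_le hw.isMacLane hvw h

lemma Contains.total {a b c : clusters L f} (hac : Contains a c) (hbc : Contains b c) :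
    Contains a b ∨ Contains b a :=
  a.2.isMacLane.le_or_le b.2.isMacLane c.2.isMacLane.isVal c.2.isMacLane.map_C hac hbc

lemma finite_setOf_contains (c : clusters L f) : {a | Contains a c}.Finite := by
  obtain ⟨N, hN⟩ := c.2.isMacLane.exists_deg_le
  have hfin : ((f.rootSet L).powerset ×ˢ (Set.Iic N ×ˢ (Set.univ : Set Prop))).Finite :=
    (f.rootSet_finite L).finite_subsets.prod ((Set.finite_Iic N).prod Set.finite_univ)
  refine Set.Finite.of_finite_image
    (f := fun a : clusters L f => (a.1.1, deg a.1.2, IsFinite a.1.2)) (hfin.subset ?_) ?_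
  · rintro _ ⟨a, ha, rfl⟩
    refine ⟨?_, hN _ a.2.isMacLane ha, trivial⟩
    change a.1.1 ⊆ _
    rw [a.2.eq_inter]
    exact Set.inter_subset_right
  · rintro ⟨⟨s, v⟩, hv⟩ ha ⟨⟨t, w⟩, hw⟩ hb heq
    simp only [Prod.mk.injEq, eq_iff_iff] at heq
    obtain ⟨rfl, hdeg, hiff⟩ := heq
    have : v = w := (Contains.total ha hb).elim (IsCluster.eq_of_le hv hw hdeg hiff)
      fun h => (IsCluster.eq_of_le hw hv hdeg.symm hiff.symm h).symm
    subst this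
    rfl

end clusters

/-! ### The smallest disc and the root of the tree -/

section extVal

variable {L : Type*} [Field L] [Algebra K L] {f : K[X]}

lemma isVal_extVal_aeval (hval : IsVal (extVal K : L → WithTop ℚ)) (α : L) :
    IsVal fun g : K[X] => extVal K (aeval α g) :=
  hval.comap (aeval α : K[X] →ₐ[K] L).toRingHom

lemma extVal_nonneg_of_mem_rootSet (hval : IsVal (extVal K : L → WithTop ℚ))
    (hext : ∀ c : K, extVal K (algebraMap K L c) = baseVal c)
    (hint : ∀ i, Valued.v (f.coeff i / f.leadingCoeff) ≤ 1) {α : L} (hα : α ∈ f.rootSet L) :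
    0 ≤ extVal K α := by
  obtain ⟨hf0, hα⟩ := mem_rootSet.1 hα
  have hlc : f.leadingCoeff ≠ 0 := leadingCoeff_ne_zero.2 hf0
  by_contra hneg
  rw [not_le] at hneg
  obtain ⟨q, hq⟩ := WithTop.ne_top_iff_exists.1 hneg.ne_top
  have hq0 : q < 0 := by rwa [← hq, WithTop.coe_lt_zero] at hneg
  have hpow : ∀ n : ℕ, extVal K (α ^ n) = ((n * q : ℚ) : WithTop ℚ) := by
    intro n
    have := hval.toAddVal.map_pow α n
    rw [hval.toAddVal_apply, hval.toAddVal_apply, ← hq, ← WithTop.coe_nsmul] at this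
    rw [this, nsmul_eq_mul]
  have hsum : α ^ f.natDegree =
      -∑ i ∈ Finset.range f.natDegree, algebraMap K L (f.coeff i / f.leadingCoeff) * α ^ i := by
    rw [aeval_eq_sum_range, Finset.sum_range_succ] at hα
    have hlc' : algebraMap K L f.leadingCoeff ≠ 0 := by simpa using hlc
    rw [eq_neg_iff_add_eq_zero]
    apply mul_left_cancel₀ hlc'
    rw [mul_zero, ← hα, mul_add, Finset.mul_sum, add_comm]
    congr 1
    · refine Finset.sum_congr rfl fun i _ => ?_
      rw [← mul_assoc, ← map_mul, mul_div_cancel₀ _ hlc, Algebra.smul_def]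
    · rw [Algebra.smul_def]; rfl
  -- If `α` had negative value, its top power would have strictly smaller value than every lower
  -- term of the equation.
  have hlt : extVal K (α ^ f.natDegree) < extVal K (α ^ f.natDegree) := by
    conv_rhs => rw [hsum, hval.map_neg]
    refine hval.toAddVal.map_lt_sum (by rw [hpow]; exact WithTop.coe_ne_top) fun i hi => ?_
    rw [hval.toAddVal_apply, hval.map_mul, hext]
    refine lt_of_lt_of_le ?_ (le_add_of_nonneg_left (baseVal_nonneg.2 (hint i)))
    rw [hpow, hpow, WithTop.coe_lt_coe]
    exact mul_lt_mul_of_neg_right (by exact_mod_cast Finset.mem_range.1 hi) hq0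
  exact lt_irrefl _ hlt

lemma extVal_eq_top (hval : IsVal (extVal K : L → WithTop ℚ)) {α : L} :
    extVal K α = ⊤ ↔ α = 0 :=
  hval.toAddVal.top_iff

/-- Translates of a root of `f` by elements of `K` have values with bounded denominators. -/
lemma exists_extVal_sub_eq [Algebra.IsAlgebraic K L] {α : L} (hα : α ∈ f.rootSet L) (b : K) (hne : α - algebraMap K L b ≠ 0) :
    ∃ z : ℤ, extVal K (α - algebraMap K L b) =
      (((z : ℚ) / (f.natDegree.factorial : ℚ) : ℚ) : WithTop ℚ) := by
  obtain ⟨hf0, hα⟩ := mem_rootSet.1 hα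
  set m := (minpoly K (α - algebraMap K L b)).natDegree with hm
  have hαi : IsIntegral K (α - algebraMap K L b) := Algebra.IsIntegral.isIntegral _
  have hmpos : 0 < m := minpoly.natDegree_pos hαi
  have hmle : m ≤ f.natDegree := by
    have : m = (minpoly K α).natDegree := by
      rw [hm, minpoly.sub_algebraMap, natDegree_comp, natDegree_X_add_C, mul_one]
    rw [this]
    exact natDegree_le_of_dvd (minpoly.dvd K α hα) hf0
  -- Translation preserves the degree `m` of the minimal polynomial, so `m ≤ deg f` and the
  -- factorial is a common denominator.
  obtain ⟨k, hk⟩ := Nat.dvd_factorial hmpos hmle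
  have hc : (minpoly K (α - algebraMap K L b)).coeff 0 ≠ 0 := minpoly.coeff_zero_ne_zero hαi hne
  refine ⟨-WithZero.log (Valued.v ((minpoly K (α - algebraMap K L b)).coeff 0)) * k, ?_⟩
  rw [extVal, baseVal_of_ne hc, WithTop.map_coe, ← hm, hk]
  congr 1
  have hk0 : (k : ℚ) ≠ 0 := by
    rintro h
    rw [Nat.cast_eq_zero] at h
    rw [h, mul_zero] at hk
    exact (Nat.factorial_pos _).ne' hk
  have hm0 : (m : ℚ) ≠ 0 := by exact_mod_cast hmpos.ne'
  push_cast
  field_simp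

/-- Among the discs with centre in `O_K` that contain all roots of `f` there is a smallest one. -/
lemma exists_smallest_disc [IsAlgClosure K L] (hval : IsVal (extVal K : L → WithTop ℚ))
    (hext : ∀ c : K, extVal K (algebraMap K L c) = baseVal c)
    (hdeg : 0 < f.natDegree) (hsep : f.Separable)
    (hint : ∀ i, Valued.v (f.coeff i / f.leadingCoeff) ≤ 1) :
    (f.rootSet L).Nonempty ∧ ∃ (a : K) (lam : WithTop ℚ), 0 ≤ baseVal a ∧ 0 ≤ lam ∧
      (∀ α ∈ f.rootSet L, lam ≤ extVal K (α - algebraMap K L a)) ∧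
      ∀ (b : K) (mu : WithTop ℚ), 0 ≤ baseVal b →
        (∀ α ∈ f.rootSet L, mu ≤ extVal K (α - algebraMap K L b)) → mu ≤ lam := by
  have : IsAlgClosed L := IsAlgClosure.isAlgClosed K
  have : Algebra.IsAlgebraic K L := IsAlgClosure.isAlgebraic
  have hf0 : f ≠ 0 := by rintro rfl; simp at hdeg
  have hcard : Fintype.card (f.rootSet L) = f.natDegree :=
    card_rootSet_eq_natDegree hsep (IsAlgClosed.splits _)
  obtain ⟨α, hα⟩ : (f.rootSet L).Nonempty := by
    have : 0 < Fintype.card (f.rootSet L) := hcard ▸ hdeg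
    obtain ⟨x⟩ := Fintype.card_pos_iff.1 this
    exact ⟨x.1, x.2⟩
  refine ⟨⟨α, hα⟩, ?_⟩
  by_cases hone : ∃ a : K, ∀ α ∈ f.rootSet L, α = algebraMap K L a
  · obtain ⟨a, ha⟩ := hone
    refine ⟨a, ⊤, ?_, le_top, fun β hβ => ?_, fun _ _ _ _ => le_top⟩
    · rw [← hext, ← ha α hα]
      exact extVal_nonneg_of_mem_rootSet hval hext hint hα
    · rw [← ha β hβ, sub_self, hval.map_zero]
  -- By separability a single root forces `deg f = 1`, and then the root lies in `K`.
  obtain ⟨β, hβ, hαβ⟩ : ∃ β ∈ f.rootSet L, α - β ≠ 0 := by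
    by_contra! hcon
    have hle : Fintype.card (f.rootSet L) ≤ 1 := Fintype.card_le_one_iff.2 fun x y =>
      Subtype.ext ((sub_eq_zero.1 (hcon x.1 x.2)).symm.trans (sub_eq_zero.1 (hcon y.1 y.2)))
    have h1 : f.natDegree = 1 := by omega
    obtain ⟨x, hx⟩ := exists_root_of_degree_eq_one
      ((degree_eq_iff_natDegree_eq_of_pos one_pos).2 h1)
    have hxm : algebraMap K L x ∈ f.rootSet L :=
      mem_rootSet.2 ⟨hf0, by
        rw [aeval_algebraMap_apply, coe_aeval_eq_eval, hx.eq_zero, map_zero]⟩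
    exact hone ⟨x, fun γ hγ => (sub_eq_zero.1 (hcon γ hγ)).symm.trans
      (sub_eq_zero.1 (hcon _ hxm))⟩
  set N : ℚ := (f.natDegree.factorial : ℚ) with hN
  have hNpos : 0 < N := by rw [hN]; exact_mod_cast Nat.factorial_pos _
  obtain ⟨B, hB⟩ := WithTop.ne_top_iff_exists.1 (mt (extVal_eq_top hval).1 hαβ)
  -- It suffices to maximise over radii in `(1/N)ℤ`. They are bounded by the value of `α - β`, and
  -- the unit disc about `0` is a candidate because the roots are integral.
  obtain ⟨z, ⟨a, ha, haz⟩, hmax⟩ := Int.exists_greatest_of_bdd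
    (P := fun z : ℤ => ∃ a : K, 0 ≤ baseVal a ∧
      ∀ α ∈ f.rootSet L, (((z : ℚ) / N : ℚ) : WithTop ℚ) ≤ extVal K (α - algebraMap K L a))
    (by
      refine ⟨⌈B * N⌉, ?_⟩
      rintro z ⟨a, -, h⟩
      have h1 := (le_min (h α hα) (h β hβ)).trans (hval.le_map_sub _ _)
      rw [sub_sub_sub_cancel_right, ← hB, WithTop.coe_le_coe, div_le_iff₀ hNpos] at h1
      exact_mod_cast h1.trans (Int.le_ceil _))
    ⟨0, 0, by simp [baseVal_zero], fun γ hγ => by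
      simpa using extVal_nonneg_of_mem_rootSet hval hext hint hγ⟩
  refine ⟨a, _, ha, ?_, haz, fun b mu hb hmu => ?_⟩
  · rw [WithTop.coe_nonneg]
    have h0 : 0 ≤ z := hmax 0 ⟨0, by simp [baseVal_zero], fun γ hγ => by
      simpa using extVal_nonneg_of_mem_rootSet hval hext hint hγ⟩
    have : (0 : ℚ) ≤ z := by exact_mod_cast h0
    positivity
  · induction mu with
    | top =>
      refine absurd ⟨b, fun γ hγ => ?_⟩ hone
      rw [← sub_eq_zero, ← extVal_eq_top hval]
      exact top_le_iff.1 (hmu γ hγ)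
    | coe q =>
      -- A radius `q` may be rounded up to the next multiple of `1/N`, since all finite values of `γ
      -- - b` are such multiples.
      have hP : ⌈q * N⌉ ≤ z := by
        refine hmax _ ⟨b, hb, fun γ hγ => ?_⟩
        have h1 := hmu γ hγ
        by_cases h0 : γ - algebraMap K L b = 0
        · rw [h0, hval.map_zero]; exact le_top
        obtain ⟨y, hy⟩ := exists_extVal_sub_eq hγ b h0
        rw [hy, WithTop.coe_le_coe, le_div_iff₀ hNpos] at h1
        rw [hy, WithTop.coe_le_coe, ← hN]
        have h2 : ((⌈q * N⌉ : ℤ) : ℚ) ≤ y := by exact_mod_cast Int.ceil_le.2 h1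
        gcongr
      rw [WithTop.coe_le_coe, le_div_iff₀ hNpos]
      exact (Int.le_ceil _).trans (by exact_mod_cast hP)

/-- The pseudo-valuation of the smallest disc containing all roots is the root of the tree. -/
lemma exists_root_cluster [IsAlgClosure K L] (hval : IsVal (extVal K : L → WithTop ℚ))
    (hext : ∀ c : K, extVal K (algebraMap K L c) = baseVal c)
    (hdeg : 0 < f.natDegree) (hsep : f.Separable)
    (hint : ∀ i, Valued.v (f.coeff i / f.leadingCoeff) ≤ 1) :
    ∃ root : clusters L f, ∀ c, Contains root c := by
  obtain ⟨hne, a, lam, ha, hlam, hR, hmax⟩ :=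
    exists_smallest_disc (L := L) hval hext hdeg hsep hint
  obtain ⟨ρ, hρ, hexp, hdρ, hfin⟩ := exists_isMacLane_hasExp_X_sub_C ha hlam
  have hvC : ∀ (α : L) (c : K), extVal K (aeval α (C c)) = baseVal c := fun α c => by
    rw [aeval_C, hext]
  have hρR : ∀ α ∈ f.rootSet L, ρ ≤ fun g => extVal K (aeval α g) := fun α hα =>
    hexp.le_of_X_sub_C hρ.map_C (isVal_extVal_aeval hval α) (hvC α) (by simpa using hR α hα)
  have hRD : ∀ v : K[X] → WithTop ℚ, v ≤ ρ → f.rootSet L = discoid L v ∩ f.rootSet L :=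
    fun v hv => (Set.inter_eq_right.2 fun α hα g => (hv g).trans (hρR α hα g)).symm
  refine ⟨⟨(f.rootSet L, ρ), hρ, hRD ρ le_rfl, hne, ?_⟩, ?_⟩
  -- If `deg w ≤ 1`, then `w` belongs to a disc about some `b` in `O_K` containing all roots.
  -- Minimality of the disc of `ρ` gives `w ≤ ρ`, a contradiction.
  · intro w hw _ hlt hwR
    refine hdρ.trans_lt (not_le.1 fun hdw => ?_)
    obtain ⟨φ, hφ, hφd⟩ := hw.exists_natDegree_eq_deg
    rcases hφ with ⟨rfl, -⟩ | ⟨u, mu, hu, hufin, hφ, hmu, rfl⟩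
    · exact hlt.not_ge hρ.gaussVal_le
    have hφ1 : φ.natDegree = 1 := le_antisymm (hφd.trans_le hdw) hφ.natDegree_pos
    obtain ⟨b, rfl⟩ : ∃ b, φ = X - C b := by
      refine ⟨-φ.coeff 0, ?_⟩
      rw [C_neg, sub_neg_eq_add]
      exact hφ.monic.eq_X_add_C hφ1
    have hwexp : HasExp (augment u (X - C b) mu) (X - C b) mu :=
      hasExp_augment hu.isVal.map_zero hφ.monic hφ.natDegree_pos
    have hwb : ∀ α ∈ f.rootSet L, mu ≤ extVal K (α - algebraMap K L b) := by
      intro α hα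
      have hαD : α ∈ discoid L (augment u (X - C b) mu) := by
        have hα' : α ∈ discoid L (augment u (X - C b) mu) ∩ f.rootSet L := hwR ▸ hα
        exact hα'.1
      have := hαD (X - C b)
      rw [hwexp.map_self hw.isVal] at this
      simpa using this
    obtain ⟨α, hα⟩ := hne
    have hα0 := extVal_nonneg_of_mem_rootSet hval hext hint hα
    -- For nonintegral `b` the value of `X - C b` at any root equals its Gauss valuation, leaving no
    -- room for `mu > u (X - C b)`.
    have hb : 0 ≤ baseVal b := by
      by_contra hneg
      rw [not_le] at hneg
      have h1 : gaussVal K (X - C b) = baseVal b := by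
        have := hasExp_gaussVal_X.map_add_mul (C (-b)) 1 (by simp)
        have e : C (-b) + X * 1 = X - C b := by rw [C_neg]; ring
        rwa [e, gaussVal_C, isVal_baseVal.map_neg, isVal_gaussVal.map_one, add_zero,
          min_eq_left hneg.le] at this
      have h2 : extVal K (α - algebraMap K L b) = baseVal b := by
        have hlt' : extVal K (-algebraMap K L b) < extVal K α := by
          rw [hval.map_neg, hext]
          exact hneg.trans_le hα0
        rw [sub_eq_add_neg, add_comm, hval.map_add_of_lt hlt', hval.map_neg, hext]
      have h3 := hwb α hα
      rw [h2, ← h1] at h3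
      exact ((hu.gaussVal_le _).trans_lt hmu).not_ge h3
    have hmulam : mu ≤ lam := hmax b mu hb hwb
    refine hlt.not_ge (hwexp.le_of_X_sub_C hw.map_C hρ.isVal hρ.map_C ?_)
    have e : (X - C b : K[X]) = (X - C a) + C (a - b) := by rw [C_sub]; ring
    have hab : mu ≤ baseVal (a - b) := by
      have h1 := hval.le_map_sub (α - algebraMap K L b) (α - algebraMap K L a)
      rw [sub_sub_sub_cancel_left, ← map_sub, hext] at h1
      exact (le_min (hwb α hα) (hmulam.trans (hR α hα))).trans h1
    rw [e]
    refine le_trans (le_min ?_ ?_) (hρ.isVal.le_map_add _ _)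
    · rwa [hexp.map_self hρ.isVal]
    · rwa [hρ.map_C]
  · rintro ⟨⟨s, v⟩, hv⟩
    change ρ ≤ v
    have hv : IsCluster L f s v := hv
    obtain ⟨α, hα⟩ := hv.nonempty
    rw [hv.eq_inter] at hα
    by_contra hnot
    have hle : v ≤ ρ := (hρ.le_or_le hv.isMacLane (isVal_extVal_aeval hval α) (hvC α)
      (hρR α hα.2) hα.1).resolve_left hnot
    have key : ∀ w : K[X] → WithTop ℚ, IsMacLane w → IsFinite w → v < w → w ≤ ρ → 1 < deg w :=
      fun w hw hwfin hlt hwρ => hv.isMacLane.one_le_deg.trans_lt <|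
        hv.deg_lt w hw hwfin hlt (hv.eq_inter.trans ((hRD v hle).symm.trans (hRD w hwρ)))
    -- For `lam = ⊤` the function `ρ` takes the value `∞` at `X - C a`, so it cannot be used to test
    -- maximality of `v`. A disc about `a` of finite radius exceeding `v (X - C a)` gives a
    -- valuation `w` with `v < w ≤ ρ` instead.
    by_cases htop : lam = ⊤
    · subst htop
      have hva : v (X - C a) ≠ ⊤ := fun h =>
        hnot (hexp.le_of_X_sub_C hρ.map_C hv.isMacLane.isVal hv.isMacLane.map_C h.ge)
      obtain ⟨q, hq⟩ := WithTop.ne_top_iff_exists.1 hva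
      have hmu : (0 : WithTop ℚ) ≤ ((max (q + 1) 0 : ℚ) : WithTop ℚ) :=
        WithTop.coe_nonneg.2 (le_max_right _ _)
      obtain ⟨w, hw, hwexp, hdw, hwfin⟩ := exists_isMacLane_hasExp_X_sub_C ha hmu
      have hwρ : w ≤ ρ := hwexp.le_of_X_sub_C hw.map_C hρ.isVal hρ.map_C
        (by rw [hexp.map_self hρ.isVal]; exact le_top)
      have hwv : ¬ w ≤ v := by
        intro h
        have h1 := h (X - C a)
        rw [hwexp.map_self hw.isVal, ← hq, WithTop.coe_le_coe] at h1
        linarith [le_max_left (q + 1) 0]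
      have hvw := (hw.le_or_le hv.isMacLane hρ.isVal hρ.map_C hwρ hle).resolve_left hwv
      exact (key w hw (hwfin WithTop.coe_ne_top) (lt_of_le_not_ge hvw hwv) hwρ).not_ge hdw
    · exact (key ρ hρ (hfin htop) (lt_of_le_not_ge hle hnot) le_rfl).not_ge hdρ

end extVal

end MacLane

theorem proposition4p9
    {K : Type*} [Field K] [Valued K (WithZero (Multiplicative ℤ))] [CompleteSpace K]
    (hK : Function.Surjective (Valued.v : Valuation K (WithZero (Multiplicative ℤ))))
    (L : Type*) [Field L] [Algebra K L] [IsAlgClosure K L]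
    (f : Polynomial K) (hdeg : 0 < f.natDegree) (hsep : f.Separable)
    (hint : ∀ i, Valued.v (f.coeff i / f.leadingCoeff) ≤ 1) :
    MacLane.IsRootedTree (MacLane.Contains (L := L) (f := f)) := by
  have : Algebra.IsAlgebraic K L := IsAlgClosure.isAlgebraic
  obtain ⟨hval, hext⟩ := MacLane.isVal_extVal hK L
  refine ⟨fun a => le_refl a.1.2, ?_, fun a b c hab hbc => le_trans (a := a.1.2) hab hbc,
    MacLane.exists_root_cluster hval hext hdeg hsep hint,
    fun a b c => MacLane.Contains.total, MacLane.finite_setOf_contains⟩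
  intro a b hab hba
  have hv : a.1.2 = b.1.2 := le_antisymm hab hba
  refine Subtype.ext (Prod.ext ?_ hv)
  rw [a.2.eq_inter, b.2.eq_inter, hv]
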